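/- Let $s\ge 1$, let $p_2=2s+1$, $r_2=s$, $s+1\le p_1\le 2s+1$, $r_1=p_1-1$, and let $h=\frac1{k+1}$ with an integer $k\ge\max\{2(s+1)-p_1,\,2\}$. For $i=1,2$ let $\mathcal S_h^{p_i,r_i}([0,1])$ be the spline space spanned by the B-splines $N_j^{p_i,r_i}$, $j=0,\dots,n_i-1$, $n_i=p_i+1+k(p_i-r_i)$, of degree $p_i$ on the knot vector in which $0$ and $1$ occur $p_i+1$ times and each of $\frac1{k+1},\dots,\frac k{k+1}$ occurs $p_i-r_i$ times. Let $\mathcal S_h^{\mathbf p_i,\mathbf r_i}([0,1]^2)=\mathcal S_h^{p_i,r_i}([0,1])\otimes\mathcal S_h^{p_i,r_i}([0,1])$ and write $N^{\mathbf p_i,\mathbf r_i}_{j_1,j_2}(x,y)=N^{p_i,r_i}_{j_1}(x)N^{p_i,r_i}_{j_2}(y)$. With $N_i^{p_1,r_1}=\sum_{j=0}^{n_2-1}\mu_j^{(i)}N_j^{p_2,r_2}$ put $\overline N_i=\sum_{j=s+1}^{n_2-s-2}\mu_j^{(i)}N_j^{p_2,r_2}$ and $\overline N_{j_1,j_2}(x,y)=\overline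 N_{j_1}(x)\overline N_{j_2}(y)$. For $n\in\{n_1,n_2\}$ let $I_n=\{s+1,\dots,n-s-2\}$ and $O_n=\{0,\dots,s\}\cup\{n-s-1,\dots,n-1\}$, and let $T=\{1,\dots,s\}\cup\{n_1-s-1,\dots,n_1-2\}$. The mixed degree and regularity spline space $\mathcal S_h^{(\mathbf p_1,\mathbf p_2),(\mathbf r_1,\mathbf r_2)}([0,1]^2)$ is the sum of the three spaces $$\mathcal S_1=\operatorname{span}\{N^{\mathbf p_1,\mathbf r_1}_{j_1,j_2}: j_1,j_2\in I_{n_1}\},$$ $$\overline{\mathcal S}_1=\operatorname{span}\{\overline N_{j_1,j_2}: j_1\in T,\ 1\le j_2\le n_1-2\}+\operatorname{span}\{\overline N_{j_1,j_2}: j_1\in I_{n_1},\ j_2\in T\},$$ $$\mathcal S_2=\operatorname{span}\{N^{\mathbf p_2,\mathbf r_2}_{j_1,j_2}: j_1\in O_{n_2},\ 0\le j_2\le n_2-1\}+\operatorname{span}\{N^{\mathbf p_2,\mathbf r_2}_{j_1,j_2}: j_1\in I_{n_2},\ j_2\in O_{n_2}\}.$$ Then $$\mathcal S_h^{\mathbf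 p_1,\mathbf r_1}([0,1]^2)\subseteq\mathcal S_h^{(\mathbf p_1,\mathbf p_2),(\mathbf r_1,\mathbf r_2)}([0,1]^2)\subseteq\mathcal S_h^{\mathbf p_2,\mathbf r_2}([0,1]^2).$$ Moreover, the mixed space locally reproduces the polynomials of bidegree at most $(p_1,p_1)$: every such polynomial $q$, restricted to $[0,1]^2$, lies in the mixed space, and for each mesh cell $Q=[ah,(a+1)h]\times[bh,(b+1)h]$, $0\le a,b\le k$, there is a function $f$ in the mixed space with $f=q$ on $Q$ that vanishes on $[0,1]^2$ outside $[(a-p_1)h,(a+1+p_1)h]\times[(b-p_1)h,(b+1+p_1)h]$. -/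

import Mathlib

noncomputable section

namespace MixedSpline

/-- The `i`-th knot (counted from `0`) of the open knot vector on `[0,1]` of degree `p` and
regularity `r` with the `k` interior knots `1/(k+1), …, k/(k+1)`: the knots `0` and `1` are
repeated `p + 1` times, each interior knot is repeated `p - r` times. -/
def knot (k p r i : ℕ) : ℝ :=
  if i ≤ p then 0
  else if i < p + 1 + k * (p - r) then (((i - (p + 1)) / (p - r) + 1 : ℕ) : ℝ) / ((k : ℝ) + 1)
  else 1

/-- The B-splines of degree `q` on a nondecreasing knot sequence `t` in `[0,1]`, through the
Cox–de Boor recursion (with `0/0 = 0`). The knot spans are half open, except that the last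
nonempty one, which ends at `1`, contains `1`. -/
def coxDeBoor (t : ℕ → ℝ) : ℕ → ℕ → ℝ → ℝ
  | 0, i, x =>
    open Classical in
    if (t i ≤ x ∧ x < t (i + 1)) ∨ (t i < t (i + 1) ∧ t (i + 1) = 1 ∧ x = 1) then 1 else 0
  | q + 1, i, x =>
    (x - t i) / (t (i + q + 1) - t i) * coxDeBoor t q i x +
      (t (i + q + 2) - x) / (t (i + q + 2) - t (i + 1)) * coxDeBoor t q (i + 1) x

/-- The number `n_{p,r} = p + 1 + k (p - r)` of B-splines. -/
def numBSplines (k p r : ℕ) : ℕ := p + 1 + k * (p - r)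

/-- The B-spline `N_i^{p,r}` on `[0,1]`, for `i = 0, …, n_{p,r} - 1`. -/
def bspline (k p r i : ℕ) : unitInterval → ℝ :=
  fun x => coxDeBoor (knot k p r) p i (x : ℝ)

/-- The spline space `S_h^{p,r}([0,1])`, `h = 1/(k+1)`: the span of its B-splines. -/
def splineSpace (k p r : ℕ) : Submodule ℝ (unitInterval → ℝ) :=
  Submodule.span ℝ (bspline k p r '' Set.Iio (numBSplines k p r))

/-- The function `(x, y) ↦ f x * g y` on the unit square. -/
def tensorFun (f g : unitInterval → ℝ) : unitInterval × unitInterval → ℝ :=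
  fun z => f z.1 * g z.2

/-- The tensor-product spline space `S_h^{p,r}([0,1]) ⊗ S_h^{p,r}([0,1])` on `[0,1]^2`. -/
def tensorSplineSpace (k p r : ℕ) : Submodule ℝ (unitInterval × unitInterval → ℝ) :=
  Submodule.span ℝ (Set.image2 tensorFun (splineSpace k p r) (splineSpace k p r))

/-- The coefficients `μ_j^{(i)}`, `j = 0, …, n_{p₂,r₂} - 1`, of `N_i^{p₁,r₁}` with respect to the
B-splines `N_j^{p₂,r₂}`. -/
def coeff (k p₁ r₁ p₂ r₂ i : ℕ) : Fin (numBSplines k p₂ r₂) → ℝ :=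
  Classical.epsilon fun μ : Fin (numBSplines k p₂ r₂) → ℝ =>
    bspline k p₁ r₁ i = ∑ j, μ j • bspline k p₂ r₂ j

/-- The truncation of `N_i^{p₁,r₁}`: in its expansion in the B-splines `N_j^{p₂,r₂}` only the terms
with `s + 1 ≤ j ≤ n_{p₂,r₂} - s - 2` are kept. -/
def truncBSpline (s k p₁ r₁ p₂ r₂ i : ℕ) : unitInterval → ℝ :=
  ∑ j ∈ Finset.univ.filter fun j : Fin (numBSplines k p₂ r₂) =>
      s + 1 ≤ (j : ℕ) ∧ (j : ℕ) ≤ numBSplines k p₂ r₂ - s - 2,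
    coeff k p₁ r₁ p₂ r₂ i j • bspline k p₂ r₂ j

/-- The indices `s + 1, …, n - s - 2`. -/
def innerIdx (s n : ℕ) : Set ℕ := Set.Icc (s + 1) (n - s - 2)

/-- The indices `1, …, s` and `n - s - 1, …, n - 2`. -/
def truncIdx (s n : ℕ) : Set ℕ := Set.Icc 1 s ∪ Set.Icc (n - s - 1) (n - 2)

/-- The indices `0, …, s` and `n - s - 1, …, n - 1`. -/
def outerIdx (s n : ℕ) : Set ℕ := Set.Icc 0 s ∪ Set.Icc (n - s - 1) (n - 1)

/-- The span of the products `N_{j₁} N_{j₂}` of members of a univariate family, `j₁ ∈ A`,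
`j₂ ∈ B`. -/
def prodSpan (N : ℕ → unitInterval → ℝ) (A B : Set ℕ) :
    Submodule ℝ (unitInterval × unitInterval → ℝ) :=
  Submodule.span ℝ (Set.image2 (fun j₁ j₂ => tensorFun (N j₁) (N j₂)) A B)

/-- `S_1([0,1]^2)`: the low degree part in the interior. -/
def lowSpace (s k p₁ r₁ : ℕ) : Submodule ℝ (unitInterval × unitInterval → ℝ) :=
  prodSpan (bspline k p₁ r₁) (innerIdx s (numBSplines k p₁ r₁))
    (innerIdx s (numBSplines k p₁ r₁))

/-- The space spanned by the truncated low degree B-splines. -/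
def truncSpace (s k p₁ r₁ p₂ r₂ : ℕ) : Submodule ℝ (unitInterval × unitInterval → ℝ) :=
  prodSpan (truncBSpline s k p₁ r₁ p₂ r₂) (truncIdx s (numBSplines k p₁ r₁))
      (Set.Icc 1 (numBSplines k p₁ r₁ - 2)) ⊔
    prodSpan (truncBSpline s k p₁ r₁ p₂ r₂) (innerIdx s (numBSplines k p₁ r₁))
      (truncIdx s (numBSplines k p₁ r₁))

/-- `S_2([0,1]^2)`: the high degree part near the boundary. -/
def highSpace (s k p₂ r₂ : ℕ) : Submodule ℝ (unitInterval × unitInterval → ℝ) :=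
  prodSpan (bspline k p₂ r₂) (outerIdx s (numBSplines k p₂ r₂))
      (Set.Icc 0 (numBSplines k p₂ r₂ - 1)) ⊔
    prodSpan (bspline k p₂ r₂) (innerIdx s (numBSplines k p₂ r₂))
      (outerIdx s (numBSplines k p₂ r₂))

/-- The mixed degree and regularity spline space `S_h^{(p₁,p₂),(r₁,r₂)}([0,1]^2)`. -/
def mixedSpace (s k p₁ r₁ p₂ r₂ : ℕ) : Submodule ℝ (unitInterval × unitInterval → ℝ) :=
  lowSpace s k p₁ r₁ ⊔ truncSpace s k p₁ r₁ p₂ r₂ ⊔ highSpace s k p₂ r₂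

/-- The restriction of a bivariate polynomial to the unit square. -/
def polyFun (q : MvPolynomial (Fin 2) ℝ) : unitInterval × unitInterval → ℝ :=
  fun z => MvPolynomial.eval ![(z.1 : ℝ), (z.2 : ℝ)] q

/-- The interval from `a h` to `b h`, `h = 1/(k+1)`. -/
def meshInterval (k : ℕ) (a b : ℤ) : Set ℝ :=
  Set.Icc ((a : ℝ) / ((k : ℝ) + 1)) ((b : ℝ) / ((k : ℝ) + 1))

/-- The spline space `V` with mesh size `1/(k+1)` locally reproduces the polynomials of bidegree at
most `(p, p)`: it contains them, and on every mesh cell each of them agrees with some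
function of `V` that vanishes more than `p` cells away from that cell. -/
def LocallyReproduces (k p : ℕ) (V : Submodule ℝ (unitInterval × unitInterval → ℝ)) : Prop :=
  ∀ q : MvPolynomial (Fin 2) ℝ, (∀ i, q.degreeOf i ≤ p) →
    polyFun q ∈ V ∧
    ∀ a b : ℕ, a ≤ k → b ≤ k → ∃ f ∈ V,
      (∀ z : unitInterval × unitInterval, (z.1 : ℝ) ∈ meshInterval k a (a + 1) →
        (z.2 : ℝ) ∈ meshInterval k b (b + 1) → f z = polyFun q z) ∧
      (∀ z : unitInterval × unitInterval, f z ≠ 0 →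
        (z.1 : ℝ) ∈ meshInterval k (a - p) (a + 1 + p) ∧
        (z.2 : ℝ) ∈ meshInterval k (b - p) (b + 1 + p))

end MixedSpline

end

/-! Everything rests on one univariate fact. A low-degree B-spline splits as N_i = M_i + e_i, where
M_i is its truncation and e_i is a combination of outer B-splines of degree p₂. Hence N_i ⊗ N_j =
M_i ⊗ M_j + e_i ⊗ N_j + M_i ⊗ e_j, and the last two terms lie in the high-degree part. If i and j
are both inner, N_i ⊗ N_j is itself a generator. Otherwise M_i ⊗ M_j is a generator of the truncated
part, unless i or j is the first or last index, which that part omits. These cases are harmless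
because M_i = 0 there (`truncBSpline_eq_zero`): the first and last B-splines are multiples of
one-sided powers, which lie in the span of the outer B-splines of degree p₂.

The univariate input is Marsden's identity. Its Taylor coefficients at a knot ξ express each
one-sided power (ξ - x)^e of admissible exponent through the B-splines on one side of ξ. Counting
dimensions, the truncated powers and the B-splines are two bases of the spline space
(`span_truncPow_eq_splineSpace`, `linearIndepOn_bspline`). Inclusions between spline spaces then
reduce to inclusions of exponent sets.

Local reproduction asserts only membership and existence, so it passes to larger spaces. It is
proved in the low-degree tensor-product space by keeping only the B-splines active on the given
cell. -/

namespace MixedSpline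

open Polynomial

/-! ### Marsden's identity -/

/-- `x` lies in the `μ`-th knot span of `t`, which is nonempty. -/
structure InKnotSpan (t : ℕ → ℝ) (x : ℝ) (μ : ℕ) : Prop where
  lt : t μ < t (μ + 1)
  zero_eq : ∀ j, coxDeBoor t 0 j x = if j = μ then 1 else 0

theorem InKnotSpan.active {t : ℕ → ℝ} {x : ℝ} {μ : ℕ} (h : InKnotSpan t x μ) (q j : ℕ)
    (hj : coxDeBoor t q j x ≠ 0) : j ≤ μ ∧ μ ≤ j + q := by
  induction q generalizing j with
  | zero =>
    rw [h.zero_eq] at hj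
    have : j = μ := by by_contra hne; simp [hne] at hj
    omega
  | succ q ih =>
    by_cases h1 : coxDeBoor t q j x = 0
    · by_cases h2 : coxDeBoor t q (j + 1) x = 0
      · simp [coxDeBoor, h1, h2] at hj
      · have := ih _ h2; omega
    · have := ih _ h1; omega

theorem InKnotSpan.eq_zero {t : ℕ → ℝ} {x : ℝ} {μ : ℕ} (h : InKnotSpan t x μ) {q j : ℕ}
    (hj : μ < j ∨ j + q < μ) : coxDeBoor t q j x = 0 := by
  by_contra hne
  have := h.active q j hne
  omega

/-- A B-spline of positive degree vanishes at the left end of its first knot span. -/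
theorem InKnotSpan.succ_self_eq_zero {t : ℕ → ℝ} {x : ℝ} {μ : ℕ} (h : InKnotSpan t x μ) {q : ℕ}
    (hx : x = t μ) : coxDeBoor t (q + 1) μ x = 0 := by
  rw [coxDeBoor, h.eq_zero (j := μ + 1) (Or.inl (Nat.lt_succ_self _))]
  simp [hx]

/-- The dual polynomial `∏ (X - t_i)`, `j < i ≤ j + q`, of the `j`-th B-spline of degree `q`. -/
noncomputable def dualPoly (t : ℕ → ℝ) (q j : ℕ) : ℝ[X] :=
  ∏ i ∈ Finset.Ico (j + 1) (j + q + 1), (X - C (t i))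

theorem dualPoly_succ_right (t : ℕ → ℝ) (q j : ℕ) :
    dualPoly t (q + 1) j = dualPoly t q j * (X - C (t (j + q + 1))) :=
  Finset.prod_Ico_succ_top (by omega) _

theorem dualPoly_succ_left (t : ℕ → ℝ) (q j : ℕ) :
    dualPoly t (q + 1) j = (X - C (t (j + 1))) * dualPoly t q (j + 1) := by
  rw [dualPoly, Finset.prod_eq_prod_Ico_succ_bot (by omega)]
  congr 2
  congr 1
  omega

/-- Induction on the degree. After an index shift in the second half of the Cox–de Boor recursion,
B_{j,q} is multiplied by a convex-type combination of X - t_{j+q+1} and X - t_j, and that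
combination equals X - x. The bounds q ≤ μ < N make the boundary terms of the shift vanish. -/
theorem InKnotSpan.marsden {t : ℕ → ℝ} (ht : Monotone t) {x : ℝ} {μ : ℕ} (h : InKnotSpan t x μ)
    {N : ℕ} (hN : μ < N) (q : ℕ) (hq : q ≤ μ) :
    ∑ j ∈ Finset.range N, C (coxDeBoor t q j x) * dualPoly t q j = (X - C x) ^ q := by
  induction q with
  | zero => simp [dualPoly, h.zero_eq, hN]
  | succ q ih =>
    set g : ℕ → ℝ[X] := fun j =>
      C ((t (j + q + 1) - x) / (t (j + q + 1) - t j) * coxDeBoor t q j x) *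
        ((X - C (t j)) * dualPoly t q j) with hg
    set f : ℕ → ℝ[X] := fun j =>
      C ((x - t j) / (t (j + q + 1) - t j) * coxDeBoor t q j x) *
        (dualPoly t q j * (X - C (t (j + q + 1)))) with hf
    have hsplit : ∀ j, C (coxDeBoor t (q + 1) j x) * dualPoly t (q + 1) j = f j + g (j + 1) := by
      intro j
      rw [coxDeBoor, C_add, add_mul]
      congr 1
      · rw [dualPoly_succ_right]
      · rw [dualPoly_succ_left]
        simp only [hg]
        rw [show j + 1 + q + 1 = j + q + 2 by omega]
    have hfg : ∀ j, f j + g j = C (coxDeBoor t q j x) * dualPoly t q j * (X - C x) := by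
      intro j
      by_cases h0 : coxDeBoor t q j x = 0
      · simp [hf, hg, h0]
      · obtain ⟨h1, h2⟩ := h.active q j h0
        -- An active B-spline has the nonempty span μ inside its support, so the convention 0/0 = 0
        -- plays no role here.
        have hd : t (j + q + 1) - t j ≠ 0 := by
          have a1 := ht h1
          have a2 := ht (show μ + 1 ≤ j + q + 1 by omega)
          have := h.lt
          intro h'
          linarith
        have e1 : (t (j + q + 1) - x) / (t (j + q + 1) - t j)
            = 1 - (x - t j) / (t (j + q + 1) - t j) := by field_simp; ring
        have e2 : C ((x - t j) / (t (j + q + 1) - t j)) * (C (t (j + q + 1)) - C (t j))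
            = C x - C (t j) := by
          rw [← C_sub, ← C_mul, div_mul_cancel₀ _ hd, C_sub]
        simp only [hf, hg, e1, C_mul, C_sub, C_1]
        linear_combination (-C (coxDeBoor t q j x) * dualPoly t q j) * e2
    have gN : g N = 0 := by simp [hg, h.eq_zero (Or.inl hN)]
    have g0 : g 0 = 0 := by simp [hg, h.eq_zero (q := q) (j := 0) (Or.inr (by omega))]
    have hshift : ∑ j ∈ Finset.range N, g (j + 1) = ∑ j ∈ Finset.range N, g j := by
      have := Finset.sum_range_succ' g N
      rw [Finset.sum_range_succ, gN, g0] at this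
      simpa using this.symm
    rw [Finset.sum_congr rfl fun j _ => hsplit j, Finset.sum_add_distrib, hshift,
      ← Finset.sum_add_distrib, Finset.sum_congr rfl fun j _ => hfg j, ← Finset.sum_mul,
      ih (by omega), pow_succ]

/-- The `m`-th Taylor coefficient at `ξ` of the `j`-th dual polynomial. -/
noncomputable def dualCoeff (t : ℕ → ℝ) (q : ℕ) (ξ : ℝ) (m j : ℕ) : ℝ :=
  (taylor ξ (dualPoly t q j)).coeff m

theorem InKnotSpan.sum_dualCoeff {t : ℕ → ℝ} (ht : Monotone t) {x : ℝ} {μ : ℕ}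
    (h : InKnotSpan t x μ) {N : ℕ} (hN : μ < N) {q : ℕ} (hq : q ≤ μ) (ξ : ℝ) (m : ℕ) :
    ∑ j ∈ Finset.range N, dualCoeff t q ξ m j * coxDeBoor t q j x
      = q.choose m * (ξ - x) ^ (q - m) := by
  have := congrArg (fun f => (taylor ξ f).coeff m) (h.marsden ht hN q hq)
  simp only [map_sum, finsetSum_coeff, taylor_mul, taylor_C, coeff_C_mul, taylor_pow, map_sub,
    taylor_X] at this
  rw [show (X + C ξ - C x : ℝ[X]) = X + C (ξ - x) by rw [C_sub]; ring, coeff_X_add_C_pow] at this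
  rw [mul_comm _ ((ξ - x) ^ (q - m)), ← this]
  exact Finset.sum_congr rfl fun j _ => mul_comm _ _

/-- The m + 1 knots equal to ξ all occur among the roots of the dual polynomial, so (X - ξ)^(m+1)
divides it. -/
theorem dualCoeff_eq_zero {t : ℕ → ℝ} {q : ℕ} {ξ : ℝ} {m j u : ℕ}
    (hu : ∀ i, u ≤ i → i ≤ u + m → t i = ξ) (h1 : j < u) (h2 : u + m ≤ j + q) :
    dualCoeff t q ξ m j = 0 := by
  have hdvd : (X - C ξ) ^ (m + 1) ∣ dualPoly t q j := by
    have : (X - C ξ) ^ (m + 1) = ∏ i ∈ Finset.Ico u (u + m + 1), (X - C (t i)) := by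
      rw [Finset.prod_congr rfl (g := fun _ => X - C ξ)]
      · simp [add_assoc]
      · intro i hi
        rw [Finset.mem_Ico] at hi
        rw [hu i hi.1 (by omega)]
    rw [this]
    apply Finset.prod_dvd_prod_of_subset
    intro i
    simp only [Finset.mem_Ico]
    omega
  obtain ⟨c, hc⟩ := hdvd
  have : X ^ (m + 1) ∣ taylor ξ (dualPoly t q j) := by
    rw [hc, taylor_mul, taylor_pow, map_sub, taylor_X, taylor_C, add_sub_cancel_right]
    exact Dvd.intro _ rfl
  exact X_pow_dvd_iff.1 this m (Nat.lt_succ_self m)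

/-! ### The knot vector -/

/-- The breakpoint `a / (k + 1)`. -/
noncomputable def breakpoint (k a : ℕ) : ℝ := (a : ℝ) / ((k : ℝ) + 1)

theorem breakpoint_zero (k : ℕ) : breakpoint k 0 = 0 := by simp [breakpoint]

theorem breakpoint_last (k : ℕ) : breakpoint k (k + 1) = 1 := by
  rw [breakpoint]; push_cast; exact div_self (by positivity)

theorem breakpoint_strictMono (k : ℕ) : StrictMono (breakpoint k) := by
  intro a b hab
  have : (a : ℝ) < b := by exact_mod_cast hab
  unfold breakpoint
  gcongr

theorem breakpoint_nonneg (k a : ℕ) : 0 ≤ breakpoint k a := by unfold breakpoint; positivity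

theorem breakpoint_le_one {k a : ℕ} (ha : a ≤ k + 1) : breakpoint k a ≤ 1 :=
  (breakpoint_last k) ▸ (breakpoint_strictMono k).monotone ha

/-- Moves the case distinction into a natural-number index, so that order properties of knots become
arithmetic. The minimum accounts for all later knots being 1. -/
theorem knot_eq_breakpoint (k p r i : ℕ) (hr : r < p) :
    knot k p r i = breakpoint k
      (if i ≤ p then 0 else min ((i - (p + 1)) / (p - r) + 1) (k + 1)) := by
  have hd : 0 < p - r := by omega
  unfold knot
  split_ifs with h1 h2
  · rw [breakpoint_zero]
  · have : (i - (p + 1)) / (p - r) < k := by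
      rw [Nat.div_lt_iff_lt_mul hd]; omega
    rw [min_eq_left (by omega)]
    rfl
  · have : k ≤ (i - (p + 1)) / (p - r) := by
      rw [Nat.le_div_iff_mul_le hd]; omega
    rw [min_eq_right (by omega), breakpoint_last]

theorem knot_monotone (k p r : ℕ) (hr : r < p) : Monotone (knot k p r) := by
  intro i j hij
  rw [knot_eq_breakpoint _ _ _ _ hr, knot_eq_breakpoint _ _ _ _ hr]
  apply (breakpoint_strictMono k).monotone
  split_ifs with h1 h2
  · exact le_rfl
  · exact Nat.zero_le _
  · omega
  · exact min_le_min_right _ (Nat.add_le_add_right (Nat.div_le_div_right (by omega)) 1)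

theorem knot_le_one (k p r i : ℕ) (hr : r < p) : knot k p r i ≤ 1 := by
  rw [knot_eq_breakpoint _ _ _ _ hr]
  apply breakpoint_le_one
  split_ifs
  · omega
  · exact min_le_right _ _

/-- The knots equal to the interior breakpoint `a / (k + 1)`. -/
theorem knot_interior {k p r a i : ℕ} (hr : r < p) (ha : a < k + 1)
    (h1 : p + 1 + a * (p - r) ≤ i) (h2 : i < p + 1 + (a + 1) * (p - r)) :
    knot k p r i = breakpoint k (a + 1) := by
  rw [knot_eq_breakpoint _ _ _ _ hr, if_neg (by omega)]
  have : (i - (p + 1)) / (p - r) = a := by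
    apply Nat.div_eq_of_lt_le <;> omega
  rw [this, min_eq_left (by omega)]

/-- The index is that of the last copy of the knot b/(k+1); the next knot is the first copy of the
following breakpoint. These are therefore the nonempty knot spans. -/
theorem knot_last_eq {k p r b : ℕ} (hr : r < p) (hb : b ≤ k) :
    knot k p r (p + b * (p - r)) = breakpoint k b := by
  rcases b with _ | b
  · rw [knot_eq_breakpoint _ _ _ _ hr, if_pos (by simp)]
  · have : (b + 1) * (p - r) = b * (p - r) + (p - r) := by ring
    exact knot_interior hr (by omega) (by omega) (by omega)

theorem knot_first_eq {k p r b : ℕ} (hr : r < p) (hb : b ≤ k) :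
    knot k p r (p + b * (p - r) + 1) = breakpoint k (b + 1) := by
  have : (b + 1) * (p - r) = b * (p - r) + (p - r) := by ring
  exact knot_interior hr (by omega) (by omega) (by omega)

theorem inKnotSpan_of_mem_Ico {k p r b : ℕ} (hr : r < p) (hb : b ≤ k) {x : ℝ}
    (h1 : breakpoint k b ≤ x) (h2 : x < breakpoint k (b + 1)) :
    InKnotSpan (knot k p r) x (p + b * (p - r)) := by
  have e1 := knot_last_eq hr hb
  have e2 := knot_first_eq hr hb
  have hm := knot_monotone k p r hr
  refine ⟨by rw [e1, e2]; exact breakpoint_strictMono k (Nat.lt_succ_self b), fun j => ?_⟩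
  have hx1 : x < 1 := h2.trans_le (breakpoint_le_one (by omega))
  rw [coxDeBoor]
  congr 1
  apply propext
  constructor
  · rintro (⟨h3, h4⟩ | ⟨-, -, h⟩)
    · rcases lt_trichotomy j (p + b * (p - r)) with h | h | h
      · have := hm (show j + 1 ≤ _ from h)
        linarith
      · exact h
      · have := hm (show _ + 1 ≤ j from h)
        linarith
    · exact absurd h hx1.ne
  · rintro rfl
    left
    rw [e1, e2]
    exact ⟨h1, h2⟩

theorem inKnotSpan_one {k p r : ℕ} (hr : r < p) :
    InKnotSpan (knot k p r) 1 (p + k * (p - r)) := by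
  have e1 := knot_last_eq (k := k) hr le_rfl
  have e2 := knot_first_eq (k := k) hr le_rfl
  have hm := knot_monotone k p r hr
  have hlt := breakpoint_strictMono k (Nat.lt_succ_self k)
  rw [breakpoint_last] at e2
  rw [Nat.succ_eq_add_one, breakpoint_last] at hlt
  refine ⟨by rw [e1, e2]; exact hlt, fun j => ?_⟩
  rw [coxDeBoor]
  congr 1
  apply propext
  constructor
  · rintro (⟨h3, h4⟩ | ⟨h3, h4, -⟩)
    · exact absurd h4 (knot_le_one k p r _ hr).not_gt
    · rcases lt_trichotomy j (p + k * (p - r)) with h | h | h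
      · have := hm (show j + 1 ≤ _ from h)
        linarith
      · exact h
      · have := hm (show _ + 1 ≤ j from h)
        linarith
  · rintro rfl
    right
    rw [e1, e2]
    exact ⟨hlt, rfl, rfl⟩

/-- Every point of `[0,1]` lies in a mesh cell, half open unless it is the last one, and the
corresponding knot span is the only active one. -/
theorem exists_cell (k : ℕ) (x : unitInterval) : ∃ b ≤ k, breakpoint k b ≤ x ∧
    (x : ℝ) ≤ breakpoint k (b + 1) ∧ ((x : ℝ) < breakpoint k (b + 1) ∨ b = k ∧ (x : ℝ) = 1) ∧
    ∀ p r, r < p → InKnotSpan (knot k p r) x (p + b * (p - r)) := by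
  rcases x.2.2.lt_or_eq with hx | hx
  · have hk : (0 : ℝ) < (k : ℝ) + 1 := by positivity
    have h0 : 0 ≤ (x : ℝ) * (k + 1) := mul_nonneg x.2.1 hk.le
    have h1 := Nat.floor_le h0
    have h2 := Nat.lt_floor_add_one ((x : ℝ) * (k + 1))
    have hb : ⌊(x : ℝ) * (k + 1)⌋₊ ≤ k := by
      rw [← Nat.lt_succ_iff, Nat.floor_lt h0]
      push_cast
      nlinarith
    have h3 : breakpoint k ⌊(x : ℝ) * (k + 1)⌋₊ ≤ x := by
      rw [breakpoint, div_le_iff₀ hk]; exact h1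
    have h4 : (x : ℝ) < breakpoint k (⌊(x : ℝ) * (k + 1)⌋₊ + 1) := by
      rw [breakpoint, lt_div_iff₀ hk]; push_cast; exact h2
    exact ⟨_, hb, h3, h4.le, Or.inl h4, fun p r hr => inKnotSpan_of_mem_Ico hr hb h3 h4⟩
  · refine ⟨k, le_rfl, ?_, ?_, Or.inr ⟨rfl, hx⟩, fun p r hr => by rw [hx]; exact inKnotSpan_one hr⟩
    · rw [hx]; exact breakpoint_le_one (by omega)
    · rw [hx, breakpoint_last]

/-! ### Truncated powers in the spline space -/

/-- The truncated power `(ξ - x) ^ e` for `ξ ≤ x`, with `ξ = i / (k + 1)`, as a function of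
`x ∈ [0,1]`. -/
noncomputable def truncPow (k : ℕ) (i : ℕ × ℕ) : unitInterval → ℝ :=
  fun x => if breakpoint k i.1 ≤ x then (breakpoint k i.1 - x) ^ i.2 else 0

/-- The truncated power `(ξ - x) ^ e` for `x < ξ`, with `ξ = i / (k + 1)`. -/
noncomputable def leftTruncPow (k : ℕ) (i : ℕ × ℕ) : unitInterval → ℝ :=
  fun x => if breakpoint k i.1 ≤ x then 0 else (breakpoint k i.1 - x) ^ i.2

theorem sum_dualCoeff_bspline {k p r : ℕ} (hr : r < p) (m : ℕ) :
    ∑ j ∈ Finset.range (numBSplines k p r), dualCoeff (knot k p r) p 0 m j • bspline k p r j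
      = (p.choose m : ℝ) • truncPow k (0, p - m) := by
  ext x
  obtain ⟨b, hb, -, -, -, hspan⟩ := exists_cell k x
  have hbd : b * (p - r) ≤ k * (p - r) := Nat.mul_le_mul_right _ hb
  simp only [Finset.sum_apply, Pi.smul_apply, smul_eq_mul, truncPow, breakpoint_zero,
    if_pos x.2.1, bspline]
  exact (hspan p r hr).sum_dualCoeff (knot_monotone k p r hr)
    (by unfold numBSplines; omega) (by omega) 0 m

/-- The sum starts at the first copy of the knot ξ = (a+1)/(k+1), so every B-spline in it vanishes
to the left of ξ. To the right of ξ, any earlier active B-spline has m + 1 copies of ξ among its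
dual roots, so its coefficient is zero and the full Marsden sum is recovered. -/
theorem sum_Ico_dualCoeff_bspline {k p r a m : ℕ} (hr : r < p) (ha : a < k) (hm : m < p - r) :
    ∑ j ∈ Finset.Ico (p + 1 + a * (p - r)) (numBSplines k p r),
        dualCoeff (knot k p r) p (breakpoint k (a + 1)) m j • bspline k p r j
      = (p.choose m : ℝ) • truncPow k (a + 1, p - m) := by
  ext x
  obtain ⟨b, hb, hx1, hx2, hx3, hspan⟩ := exists_cell k x
  have hbd : b * (p - r) ≤ k * (p - r) := Nat.mul_le_mul_right _ hb
  have hspan := hspan p r hr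
  have hexp : (a + 1) * (p - r) = a * (p - r) + (p - r) := by ring
  simp only [Finset.sum_apply, Pi.smul_apply, smul_eq_mul, truncPow, bspline]
  split_ifs with hx
  · have hab : a + 1 ≤ b := by
      rcases hx3 with h | ⟨rfl, -⟩
      · have := (breakpoint_strictMono k).lt_iff_lt.1 (hx.trans_lt h)
        omega
      · omega
    have := Nat.mul_le_mul_right (p - r) hab
    rw [← hspan.sum_dualCoeff (knot_monotone k p r hr) (N := numBSplines k p r)
      (by unfold numBSplines; omega) (by omega) (breakpoint k (a + 1)) m]
    apply Finset.sum_subset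
    · intro j
      simp only [Finset.mem_Ico, Finset.mem_range]
      omega
    · intro j hj hj'
      simp only [Finset.mem_Ico, Finset.mem_range] at hj hj'
      by_cases h0 : coxDeBoor (knot k p r) p j x = 0
      · rw [h0, mul_zero]
      · have := hspan.active p j h0
        rw [dualCoeff_eq_zero (u := p + 1 + a * (p - r)) _ (by omega) (by omega), zero_mul]
        intro i h1 h2
        exact knot_interior hr (by omega) h1 (by omega)
  · have hab : b < a + 1 := by
      by_contra hcon
      exact hx (((breakpoint_strictMono k).monotone (not_lt.1 hcon)).trans hx1)
    have := Nat.mul_le_mul_right (p - r) (Nat.lt_succ_iff.1 hab)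
    rw [mul_zero]
    apply Finset.sum_eq_zero
    intro j hj
    rw [Finset.mem_Ico] at hj
    rw [hspan.eq_zero (Or.inl (by omega)), mul_zero]

/-- Mirror image: these are the B-splines whose support ends no later than ξ. Those starting before
ξ and ending beyond it have zero coefficient. -/
theorem sum_range_dualCoeff_bspline {k p r a m : ℕ} (hr : r < p) (ha : a < k) (hm : m < p - r) :
    ∑ j ∈ Finset.range ((a + 1) * (p - r)),
        dualCoeff (knot k p r) p (breakpoint k (a + 1)) m j • bspline k p r j
      = (p.choose m : ℝ) • leftTruncPow k (a + 1, p - m) := by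
  ext x
  obtain ⟨b, hb, hx1, hx2, hx3, hspan⟩ := exists_cell k x
  have hbd : b * (p - r) ≤ k * (p - r) := Nat.mul_le_mul_right _ hb
  have had : (a + 1) * (p - r) ≤ k * (p - r) := Nat.mul_le_mul_right _ ha
  have hspan := hspan p r hr
  have hexp : (a + 1) * (p - r) = a * (p - r) + (p - r) := by ring
  simp only [Finset.sum_apply, Pi.smul_apply, smul_eq_mul, leftTruncPow, bspline]
  split_ifs with hx
  · have hab : a + 1 ≤ b := by
      rcases hx3 with h | ⟨rfl, -⟩
      · have := (breakpoint_strictMono k).lt_iff_lt.1 (hx.trans_lt h)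
        omega
      · omega
    have := Nat.mul_le_mul_right (p - r) hab
    rw [mul_zero]
    apply Finset.sum_eq_zero
    intro j hj
    rw [Finset.mem_range] at hj
    rw [hspan.eq_zero (Or.inr (by omega)), mul_zero]
  · have hab : b < a + 1 := by
      by_contra hcon
      exact hx (((breakpoint_strictMono k).monotone (not_lt.1 hcon)).trans hx1)
    have := Nat.mul_le_mul_right (p - r) (Nat.lt_succ_iff.1 hab)
    rw [← hspan.sum_dualCoeff (knot_monotone k p r hr) (N := numBSplines k p r)
      (by unfold numBSplines; omega) (by omega) (breakpoint k (a + 1)) m]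
    apply Finset.sum_subset
    · intro j
      simp only [numBSplines, Finset.mem_range]
      omega
    · intro j hj hj'
      simp only [Finset.mem_range] at hj hj'
      by_cases h0 : coxDeBoor (knot k p r) p j x = 0
      · rw [h0, mul_zero]
      · have := hspan.active p j h0
        rw [dualCoeff_eq_zero (u := p + 1 + a * (p - r)) _ (by omega) (by omega), zero_mul]
        intro i h1 h2
        exact knot_interior hr (by omega) h1 (by omega)

theorem mem_span_of_sum_eq_choose_smul {V : Type*} [AddCommGroup V] [Module ℝ V] {c : ℕ → ℝ}
    {v : ℕ → V} {s : Finset ℕ} {A : Set ℕ} (hsA : ∀ j ∈ s, j ∈ A) {p m : ℕ} (hm : m ≤ p) {w : V}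
    (h : ∑ j ∈ s, c j • v j = (p.choose m : ℝ) • w) : w ∈ Submodule.span ℝ (v '' A) := by
  have hne : (p.choose m : ℝ) ≠ 0 := by exact_mod_cast (Nat.choose_pos hm).ne'
  rw [← Submodule.smul_mem_iff _ hne, ← h]
  exact Submodule.sum_mem _ fun j hj =>
    Submodule.smul_mem _ _ (Submodule.subset_span ⟨j, hsA j hj, rfl⟩)

/-- The indices of the truncated powers that span `S_h^{p,r}`. -/
def truncPowIdx (k p r : ℕ) : Finset (ℕ × ℕ) :=
  {0} ×ˢ Finset.range (p + 1) ∪ Finset.Icc 1 k ×ˢ Finset.Ioc r p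

theorem card_truncPowIdx (k p r : ℕ) : (truncPowIdx k p r).card = numBSplines k p r := by
  rw [truncPowIdx, Finset.card_union_of_disjoint, Finset.card_product, Finset.card_product]
  · simp [numBSplines]
  · rw [Finset.disjoint_left]
    rintro ⟨i, e⟩
    simp only [Finset.mem_product, Finset.mem_singleton, Finset.mem_Icc]
    omega

theorem truncPow_mem_splineSpace {k p r : ℕ} (hr : r < p) {i : ℕ × ℕ}
    (hi : i ∈ truncPowIdx k p r) : truncPow k i ∈ splineSpace k p r := by
  obtain ⟨a, e⟩ := i
  simp only [truncPowIdx, Finset.mem_union, Finset.mem_product, Finset.mem_singleton,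
    Finset.mem_range, Finset.mem_Icc, Finset.mem_Ioc] at hi
  rcases hi with ⟨rfl, he⟩ | ⟨⟨ha, hak⟩, he⟩
  · have := sum_dualCoeff_bspline (k := k) hr (p - e)
    rw [Nat.sub_sub_self (by omega)] at this
    refine mem_span_of_sum_eq_choose_smul (fun j hj => ?_) (by omega) this
    simpa using hj
  · obtain ⟨a, rfl⟩ := Nat.exists_eq_add_of_le' ha
    have := sum_Ico_dualCoeff_bspline (k := k) (a := a) (m := p - e) hr (by omega) (by omega)
    rw [Nat.sub_sub_self (by omega)] at this
    refine mem_span_of_sum_eq_choose_smul (fun j hj => ?_) (by omega) this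
    exact (Finset.mem_Ico.1 hj).2

/-! ### Linear independence and dimension -/

/-- Sweep the cells from left to right. On the a-th cell only powers based at breakpoints up to the
a-th survive, and the earlier polynomials are already zero, so the a-th polynomial has infinitely
many roots. -/
theorem linearIndepOn_truncPow (k p : ℕ) :
    LinearIndepOn ℝ (truncPow k)
      (Finset.range (k + 1) ×ˢ Finset.range (p + 1) : Finset (ℕ × ℕ)) := by
  rw [linearIndepOn_finset_iff]
  intro c hc
  set P : ℕ → ℝ[X] := fun a =>
    ∑ e ∈ Finset.range (p + 1), C (c (a, e)) * (C (breakpoint k a) - X) ^ e with hP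
  have hsum : ∀ x : unitInterval, ∑ a ∈ Finset.range (k + 1),
      (if breakpoint k a ≤ x then (P a).eval (x : ℝ) else 0) = 0 := by
    intro x
    have := congrFun hc x
    rw [Finset.sum_product, Finset.sum_apply, Pi.zero_apply] at this
    refine Eq.trans ?_ this
    apply Finset.sum_congr rfl
    intro a _
    simp only [Finset.sum_apply, Pi.smul_apply, smul_eq_mul, truncPow, hP]
    split_ifs
    · simp [eval_finsetSum]
    · simp
  have hzero : ∀ a, a < k + 1 → P a = 0 := by
    intro a
    induction a using Nat.strong_induction_on with
    | _ a ih =>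
      intro ha
      apply eq_zero_of_infinite_isRoot
      refine (Set.Ioo_infinite (breakpoint_strictMono k (Nat.lt_succ_self a))).mono ?_
      rintro x ⟨hx1, hx2⟩
      have h0 : 0 ≤ x := (breakpoint_nonneg k a).trans hx1.le
      have h1 : x ≤ 1 := hx2.le.trans (breakpoint_le_one (by omega))
      have := hsum ⟨x, h0, h1⟩
      rw [Finset.sum_eq_single a] at this
      · rwa [if_pos hx1.le] at this
      · intro b hb hba
        rcases lt_or_gt_of_ne hba with h | h
        · rw [ih b h (by omega)]; simp
        · rw [if_neg]
          have := (breakpoint_strictMono k).monotone (show a + 1 ≤ b from h)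
          exact not_le.2 (hx2.trans_le this)
      · intro h
        exact absurd (Finset.mem_range.2 ha) h
  rintro ⟨a, e⟩ hae
  rw [Finset.mem_product, Finset.mem_range, Finset.mem_range] at hae
  -- The substitution X ↦ ξ - X turns the powers of ξ - X into monomials, whose coefficients can be
  -- read off.
  have h1 : (P a).comp (C (breakpoint k a) - X)
      = ∑ e ∈ Finset.range (p + 1), C (c (a, e)) * X ^ e := by
    simp [hP, Polynomial.sum_comp]
  rw [hzero a hae.1, zero_comp] at h1
  have h2 := congrArg (fun f : ℝ[X] => f.coeff e) h1
  simp only [coeff_zero, finsetSum_coeff, coeff_C_mul_X_pow] at h2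
  rw [Finset.sum_eq_single e] at h2
  · simpa using h2.symm
  · intro b _ hb
    rw [if_neg hb.symm]
  · intro h
    exact absurd (Finset.mem_range.2 hae.2) h

theorem finrank_span_truncPow (k p r : ℕ) :
    Module.finrank ℝ (Submodule.span ℝ (truncPow k '' (truncPowIdx k p r : Set (ℕ × ℕ))))
      = numBSplines k p r := by
  have hsub : (truncPowIdx k p r : Set (ℕ × ℕ)) ⊆
      (Finset.range (k + 1) ×ˢ Finset.range (p + 1) : Finset (ℕ × ℕ)) := by
    rintro ⟨a, e⟩
    simp only [truncPowIdx, Finset.coe_union, Set.mem_union, Finset.mem_coe, Finset.mem_product,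
      Finset.mem_singleton, Finset.mem_range, Finset.mem_Icc, Finset.mem_Ioc]
    omega
  have := finrank_span_eq_card ((linearIndepOn_truncPow k p).mono hsub)
  rw [Set.image_eq_range]
  rw [← card_truncPowIdx]
  exact this.trans (Fintype.card_coe _)

theorem finrank_splineSpace_le (k p r : ℕ) :
    Module.finrank ℝ (splineSpace k p r) ≤ numBSplines k p r := by
  have := finrank_range_le_card (R := ℝ) (fun j : Set.Iio (numBSplines k p r) => bspline k p r j)
  rw [splineSpace, Set.image_eq_range]
  simpa [Set.finrank] using this

instance finiteDimensional_splineSpace (k p r : ℕ) : FiniteDimensional ℝ (splineSpace k p r) :=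
  FiniteDimensional.span_of_finite ℝ ((Set.finite_Iio _).image _)

/-- The Curry–Schoenberg theorem. -/
theorem span_truncPow_eq_splineSpace {k p r : ℕ} (hr : r < p) :
    Submodule.span ℝ (truncPow k '' (truncPowIdx k p r : Set (ℕ × ℕ))) = splineSpace k p r := by
  -- Marsden gives one inclusion. Equality follows because n independent truncated powers lie in a
  -- space spanned by n functions.
  apply Submodule.eq_of_le_of_finrank_le
  · rw [Submodule.span_le]
    rintro _ ⟨i, hi, rfl⟩
    exact truncPow_mem_splineSpace hr hi
  · rw [finrank_span_truncPow]
    exact finrank_splineSpace_le k p r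

theorem linearIndepOn_bspline {k p r : ℕ} (hr : r < p) :
    LinearIndepOn ℝ (bspline k p r) (Set.Iio (numBSplines k p r)) := by
  rw [LinearIndepOn, linearIndependent_iff_card_eq_finrank_span]
  have h := finrank_span_truncPow k p r
  rw [span_truncPow_eq_splineSpace hr, splineSpace, Set.image_eq_range] at h
  rw [Set.finrank, h]
  simp

/-- In the truncated-power bases the inclusion is just that of the index sets. -/
theorem splineSpace_mono {k p p' r r' : ℕ} (hr : r < p) (hr' : r' < p') (hrr : r' ≤ r)
    (hpp : p ≤ p') : splineSpace k p r ≤ splineSpace k p' r' := by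
  rw [← span_truncPow_eq_splineSpace hr, ← span_truncPow_eq_splineSpace hr']
  apply Submodule.span_mono
  apply Set.image_mono
  rintro ⟨a, e⟩
  simp only [truncPowIdx, Finset.coe_union, Set.mem_union, Finset.mem_coe, Finset.mem_product,
    Finset.mem_singleton, Finset.mem_range, Finset.mem_Icc, Finset.mem_Ioc]
  omega

/-! ### The extreme B-splines and truncation -/

/-- At the first interior knot h, maximal smoothness leaves a single term in the one-sided sum, so
the B-spline is a multiple of the left power (h - x)^p. With multiplicity s + 1, the same power,
taken as Taylor order m = p' - p in degree p', involves only the first s + 1 B-splines. -/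
theorem bspline_zero_mem_span_outer {s k p p' r' : ℕ} (hp : 1 ≤ p) (hk : 1 ≤ k)
    (hr' : r' + (s + 1) = p') (hpp : p ≤ p') (hrp : r' < p) :
    bspline k p (p - 1) 0 ∈ Submodule.span ℝ
      (bspline k p' r' '' outerIdx s (numBSplines k p' r')) := by
  have hd : p - (p - 1) = 1 := by omega
  have hd' : p' - r' = s + 1 := by omega
  have h1 := sum_range_dualCoeff_bspline (k := k) (p := p) (r := p - 1) (a := 0) (m := 0)
    (by omega) (by omega) (by omega)
  have h2 := sum_range_dualCoeff_bspline (k := k) (p := p') (r := r') (a := 0) (m := p' - p)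
    (by omega) (by omega) (by omega)
  rw [hd, Nat.sub_zero, zero_add, one_mul, Finset.sum_range_one, Nat.choose_zero_right,
    Nat.cast_one, one_smul] at h1
  rw [Nat.sub_sub_self hpp] at h2
  have h3 : leftTruncPow k (0 + 1, p) ∈ Submodule.span ℝ
      (bspline k p' r' '' outerIdx s (numBSplines k p' r')) := by
    refine mem_span_of_sum_eq_choose_smul (fun j hj => ?_) (by omega) h2
    rw [zero_add, one_mul, hd', Finset.mem_range] at hj
    left
    exact ⟨Nat.zero_le _, by omega⟩
  -- If the coefficient were zero, the one-sided power would vanish at x = 0, where its value is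
  -- h^p.
  have hc : dualCoeff (knot k p (p - 1)) p (breakpoint k (0 + 1)) 0 0 ≠ 0 := by
    intro hc
    have h0 := congrFun h1 0
    have hpos := breakpoint_strictMono k Nat.zero_lt_one
    rw [breakpoint_zero] at hpos
    rw [zero_add] at hc
    rw [hc, zero_smul, Pi.zero_apply, leftTruncPow, if_neg (by simpa using hpos)] at h0
    have : (breakpoint k 1) ^ p ≠ 0 := (pow_pos hpos p).ne'
    exact this (by simpa using h0.symm)
  rw [← Submodule.smul_mem_iff _ hc, zero_add, h1]
  exact h3

theorem bspline_last_mem_span_outer {s k p p' r' : ℕ} (hp : 1 ≤ p) (hk : 1 ≤ k)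
    (hr' : r' + (s + 1) = p') (hpp : p ≤ p') (hrp : r' < p) :
    bspline k p (p - 1) (numBSplines k p (p - 1) - 1) ∈ Submodule.span ℝ
      (bspline k p' r' '' outerIdx s (numBSplines k p' r')) := by
  have hd : p - (p - 1) = 1 := by omega
  have hd' : p' - r' = s + 1 := by omega
  have h1 := sum_Ico_dualCoeff_bspline (k := k) (p := p) (r := p - 1) (a := k - 1) (m := 0)
    (by omega) (by omega) (by omega)
  have h2 := sum_Ico_dualCoeff_bspline (k := k) (p := p') (r := r') (a := k - 1) (m := p' - p)
    (by omega) (by omega) (by omega)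
  have hn : numBSplines k p (p - 1) = p + 1 + (k - 1) * (p - (p - 1)) + 1 := by
    rw [numBSplines, hd]; omega
  rw [hn, Nat.Ico_succ_singleton, Finset.sum_singleton, Nat.choose_zero_right, Nat.cast_one,
    one_smul, Nat.sub_zero, Nat.sub_add_cancel hk] at h1
  rw [Nat.sub_sub_self hpp, Nat.sub_add_cancel hk] at h2
  rw [hn, Nat.add_sub_cancel]
  have h3 : truncPow k (k, p) ∈ Submodule.span ℝ
      (bspline k p' r' '' outerIdx s (numBSplines k p' r')) := by
    refine mem_span_of_sum_eq_choose_smul (fun j hj => ?_) (by omega) h2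
    rw [Finset.mem_Ico] at hj
    right
    refine ⟨le_trans ?_ hj.1, by omega⟩
    obtain ⟨k, rfl⟩ := Nat.exists_eq_add_of_le' hk
    have : (k + 1) * (p' - r') = k * (p' - r') + (p' - r') := by ring
    rw [numBSplines, Nat.add_sub_cancel]
    omega
  have hc : dualCoeff (knot k p (p - 1)) p (breakpoint k k) 0
      (p + 1 + (k - 1) * (p - (p - 1))) ≠ 0 := by
    intro hc
    have h0 := congrFun h1 1
    have hlt := breakpoint_strictMono k (Nat.lt_succ_self k)
    rw [Nat.succ_eq_add_one, breakpoint_last] at hlt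
    rw [hc, zero_smul, Pi.zero_apply, truncPow, if_pos (by simpa using hlt.le)] at h0
    have := pow_ne_zero p (sub_ne_zero.2 hlt.ne)
    exact this h0.symm
  rw [← Submodule.smul_mem_iff _ hc, h1]
  exact h3

theorem exists_coeff_of_mem_splineSpace {k p r : ℕ} {f : unitInterval → ℝ}
    (hf : f ∈ splineSpace k p r) :
    ∃ c : ℕ → ℝ, ∑ j ∈ Finset.range (numBSplines k p r), c j • bspline k p r j = f := by
  rw [splineSpace, ← Finset.coe_range, Submodule.mem_span_image_finset_iff_exists_fun] at hf
  obtain ⟨c, rfl⟩ := hf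
  refine ⟨fun j => if h : j ∈ Finset.range (numBSplines k p r) then c ⟨j, h⟩ else 0, ?_⟩
  rw [← Finset.sum_coe_sort]
  refine Finset.sum_congr rfl fun j _ => ?_
  exact congrArg (· • bspline k p r j) (dif_pos j.2)

/-- The choice operator returns genuine coefficients only once some expansion is known to exist. -/
theorem coeff_spec {k p₁ r₁ p₂ r₂ i : ℕ} (h : bspline k p₁ r₁ i ∈ splineSpace k p₂ r₂) :
    bspline k p₁ r₁ i = ∑ j, coeff k p₁ r₁ p₂ r₂ i j • bspline k p₂ r₂ j := by
  refine Classical.epsilon_spec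
    (p := fun μ : Fin (numBSplines k p₂ r₂) → ℝ =>
      bspline k p₁ r₁ i = ∑ j, μ j • bspline k p₂ r₂ j) ?_
  obtain ⟨c, hc⟩ := exists_coeff_of_mem_splineSpace h
  refine ⟨fun j => c j, ?_⟩
  rw [← hc, Finset.sum_range]

/-- Truncation removes only B-splines with outer indices. -/
theorem bspline_sub_truncBSpline_mem {s k p₁ r₁ p₂ r₂ i : ℕ}
    (h : bspline k p₁ r₁ i ∈ splineSpace k p₂ r₂) :
    bspline k p₁ r₁ i - truncBSpline s k p₁ r₁ p₂ r₂ i ∈ Submodule.span ℝ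
      (bspline k p₂ r₂ '' outerIdx s (numBSplines k p₂ r₂)) := by
  rw [truncBSpline, sub_eq_of_eq_add' ((coeff_spec h).trans (Finset.sum_filter_add_sum_filter_not _
    (fun j : Fin (numBSplines k p₂ r₂) =>
      s + 1 ≤ (j : ℕ) ∧ (j : ℕ) ≤ numBSplines k p₂ r₂ - s - 2) _).symm)]
  refine Submodule.sum_mem _ fun j hj => Submodule.smul_mem _ _ (Submodule.subset_span ⟨j, ?_, rfl⟩)
  have := j.2
  rw [Finset.mem_filter] at hj
  simp only [outerIdx, Set.mem_union, Set.mem_Icc]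
  omega

theorem truncBSpline_mem_span_inner (s k p₁ r₁ p₂ r₂ i : ℕ) :
    truncBSpline s k p₁ r₁ p₂ r₂ i ∈ Submodule.span ℝ
      (bspline k p₂ r₂ '' innerIdx s (numBSplines k p₂ r₂)) :=
  Submodule.sum_mem _ fun j hj => Submodule.smul_mem _ _
    (Submodule.subset_span ⟨j, (Finset.mem_filter.1 hj).2, rfl⟩)

/-- The truncation always lies in the inner span. Under the last hypothesis it also lies in the
outer span, and the two meet only in 0 by linear independence. -/
theorem truncBSpline_eq_zero {s k p₁ r₁ p₂ r₂ i : ℕ} (hr₂ : r₂ < p₂)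
    (hn : 2 * s + 3 ≤ numBSplines k p₂ r₂)
    (h : bspline k p₁ r₁ i ∈ splineSpace k p₂ r₂)
    (hi : bspline k p₁ r₁ i ∈ Submodule.span ℝ
      (bspline k p₂ r₂ '' outerIdx s (numBSplines k p₂ r₂))) :
    truncBSpline s k p₁ r₁ p₂ r₂ i = 0 := by
  have hout : truncBSpline s k p₁ r₁ p₂ r₂ i ∈ Submodule.span ℝ
      (bspline k p₂ r₂ '' outerIdx s (numBSplines k p₂ r₂)) := by
    simpa using Submodule.sub_mem _ hi (bspline_sub_truncBSpline_mem (s := s) h)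
  have hdisj : Disjoint
      (Submodule.span ℝ (bspline k p₂ r₂ '' innerIdx s (numBSplines k p₂ r₂)))
      (Submodule.span ℝ (bspline k p₂ r₂ '' outerIdx s (numBSplines k p₂ r₂))) := by
    have hind := linearIndepOn_bspline (k := k) hr₂
    have himg : ∀ A ⊆ Set.Iio (numBSplines k p₂ r₂), bspline k p₂ r₂ '' A =
        (fun j : Set.Iio (numBSplines k p₂ r₂) => bspline k p₂ r₂ j) ''
          {j | (j : ℕ) ∈ A} := by
      intro A hA
      ext f
      constructor
      · rintro ⟨j, hj, rfl⟩
        exact ⟨⟨j, hA hj⟩, hj, rfl⟩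
      · rintro ⟨j, hj, rfl⟩
        exact ⟨j, hj, rfl⟩
    rw [himg (innerIdx s _), himg (outerIdx s _)]
    · refine LinearIndependent.disjoint_span_image hind ?_
      rw [Set.disjoint_left]
      simp only [innerIdx, outerIdx, Set.mem_union, Set.mem_Icc, Set.mem_ofPred_eq]
      omega
    · intro j
      simp only [outerIdx, Set.mem_union, Set.mem_Icc, Set.mem_Iio]
      omega
    · intro j
      simp only [innerIdx, Set.mem_Icc, Set.mem_Iio]
      omega
  exact (Submodule.disjoint_def.1 hdisj) _ (truncBSpline_mem_span_inner s k p₁ r₁ p₂ r₂ i) hout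

/-! ### Tensor products -/

/-- `tensorFun` as a bilinear map. -/
noncomputable def tensorBilin :
    (unitInterval → ℝ) →ₗ[ℝ] (unitInterval → ℝ) →ₗ[ℝ] (unitInterval × unitInterval → ℝ) :=
  LinearMap.mk₂ ℝ tensorFun
    (fun _ _ _ => funext fun _ => add_mul _ _ _) (fun _ _ _ => funext fun _ => mul_assoc _ _ _)
    (fun _ _ _ => funext fun _ => mul_add _ _ _)
    (fun _ _ _ => funext fun _ => mul_left_comm _ _ _)

/-- Lets products of arbitrary combinations, not only of generators, be recognised as members. -/
theorem prodSpan_eq_map₂ (N : ℕ → unitInterval → ℝ) (A B : Set ℕ) :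
    prodSpan N A B = Submodule.map₂ tensorBilin (Submodule.span ℝ (N '' A))
      (Submodule.span ℝ (N '' B)) := by
  rw [Submodule.map₂_span_span, Set.image2_image_left, Set.image2_image_right]
  rfl

theorem tensorSplineSpace_eq_map₂ (k p r : ℕ) : tensorSplineSpace k p r =
    Submodule.map₂ tensorBilin (splineSpace k p r) (splineSpace k p r) := by
  have := Submodule.map₂_span_span ℝ tensorBilin (splineSpace k p r : Set (unitInterval → ℝ))
    (splineSpace k p r)
  rw [Submodule.span_eq] at this
  exact this.symm

theorem tensorSplineSpace_eq_prodSpan (k p r : ℕ) : tensorSplineSpace k p r =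
    prodSpan (bspline k p r) (Set.Iio (numBSplines k p r)) (Set.Iio (numBSplines k p r)) := by
  rw [tensorSplineSpace_eq_map₂, prodSpan_eq_map₂]
  rfl

theorem tensorFun_mem_tensorSplineSpace {k p r : ℕ} {f g : unitInterval → ℝ}
    (hf : f ∈ splineSpace k p r) (hg : g ∈ splineSpace k p r) :
    tensorFun f g ∈ tensorSplineSpace k p r :=
  Submodule.subset_span ⟨f, hf, g, hg, rfl⟩

theorem prodSpan_le_tensorSplineSpace {k p r : ℕ} {N : ℕ → unitInterval → ℝ} {A B : Set ℕ}
    (hA : ∀ j ∈ A, N j ∈ splineSpace k p r) (hB : ∀ j ∈ B, N j ∈ splineSpace k p r) :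
    prodSpan N A B ≤ tensorSplineSpace k p r := by
  refine Submodule.span_mono ?_
  rintro _ ⟨i, hi, j, hj, rfl⟩
  exact ⟨_, hA i hi, _, hB j hj, rfl⟩

theorem tensorFun_mem_highSpace {s k p r : ℕ} {f g : unitInterval → ℝ}
    (hf : f ∈ Submodule.span ℝ (bspline k p r '' outerIdx s (numBSplines k p r)))
    (hg : g ∈ splineSpace k p r) : tensorFun f g ∈ highSpace s k p r := by
  refine Submodule.mem_sup_left ?_
  rw [prodSpan_eq_map₂]
  have : Set.Icc 0 (numBSplines k p r - 1) = Set.Iio (numBSplines k p r) := by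
    ext j
    simp only [Set.mem_Icc, Set.mem_Iio, numBSplines]
    omega
  rw [this]
  exact Submodule.apply_mem_map₂ tensorBilin hf hg

theorem tensorFun_mem_highSpace' {s k p r : ℕ} {f g : unitInterval → ℝ}
    (hf : f ∈ Submodule.span ℝ (bspline k p r '' innerIdx s (numBSplines k p r)))
    (hg : g ∈ Submodule.span ℝ (bspline k p r '' outerIdx s (numBSplines k p r))) :
    tensorFun f g ∈ highSpace s k p r := by
  refine Submodule.mem_sup_right ?_
  rw [prodSpan_eq_map₂]
  exact Submodule.apply_mem_map₂ tensorBilin hf hg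

/-- The asymmetry is deliberate: the full g meets the "outer × all" part of the high-degree space,
and the truncated f' meets its "inner × outer" part. -/
theorem tensorFun_split (f f' g g' : unitInterval → ℝ) :
    tensorFun f g = tensorFun f' g' + (tensorFun (f - f') g + tensorFun f' (g - g')) := by
  ext z
  simp only [tensorFun, Pi.add_apply, Pi.sub_apply]
  ring

/-! ### The inclusions -/

theorem bspline_mem_splineSpace {k p r j : ℕ} (hj : j < numBSplines k p r) :
    bspline k p r j ∈ splineSpace k p r :=
  Submodule.subset_span ⟨j, hj, rfl⟩

theorem tensorSplineSpace_le_mixedSpace {s k p₁ p₂ : ℕ} (hs : 1 ≤ s) (hp₂ : p₂ = 2 * s + 1)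
    (hp₁ : s + 1 ≤ p₁) (hp₁' : p₁ ≤ 2 * s + 1) (hk : max (2 * (s + 1) - p₁) 2 ≤ k) :
    tensorSplineSpace k p₁ (p₁ - 1) ≤ mixedSpace s k p₁ (p₁ - 1) p₂ s := by
  have hk1 : 2 * (s + 1) - p₁ ≤ k := (le_max_left _ _).trans hk
  have hk2 : 2 ≤ k := (le_max_right _ _).trans hk
  have hn₁ : numBSplines k p₁ (p₁ - 1) = p₁ + 1 + k := by
    rw [numBSplines, show p₁ - (p₁ - 1) = 1 by omega, mul_one]
  have hn₂ : 2 * s + 3 ≤ numBSplines k p₂ s := by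
    have := Nat.mul_le_mul (show 1 ≤ k by omega) (show 1 ≤ p₂ - s by omega)
    unfold numBSplines
    omega
  have hle : splineSpace k p₁ (p₁ - 1) ≤ splineSpace k p₂ s :=
    splineSpace_mono (by omega) (by omega) (by omega) (by omega)
  have hmem : ∀ i < p₁ + 1 + k, bspline k p₁ (p₁ - 1) i ∈ splineSpace k p₂ s := fun i hi =>
    hle (bspline_mem_splineSpace (by omega))
  have h0 : truncBSpline s k p₁ (p₁ - 1) p₂ s 0 = 0 :=
    truncBSpline_eq_zero (by omega) hn₂ (hmem 0 (by omega))
      (bspline_zero_mem_span_outer (by omega) (by omega) (by omega) (by omega) (by omega))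
  have h1 : truncBSpline s k p₁ (p₁ - 1) p₂ s (p₁ + k) = 0 := by
    have := bspline_last_mem_span_outer (s := s) (k := k) (p := p₁) (p' := p₂) (r' := s)
      (by omega) (by omega) (by omega) (by omega) (by omega)
    rw [show numBSplines k p₁ (p₁ - 1) - 1 = p₁ + k by omega] at this
    exact truncBSpline_eq_zero (by omega) hn₂ (hmem _ (by omega)) this
  rw [tensorSplineSpace_eq_prodSpan, prodSpan, Submodule.span_le]
  rintro _ ⟨i, hi, j, hj, rfl⟩
  rw [Set.mem_Iio, hn₁] at hi hj
  show tensorFun (bspline k p₁ (p₁ - 1) i) (bspline k p₁ (p₁ - 1) j) ∈ mixedSpace _ _ _ _ _ _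
  by_cases hin : i ∈ innerIdx s (p₁ + 1 + k) ∧ j ∈ innerIdx s (p₁ + 1 + k)
  · refine Submodule.mem_sup_left (Submodule.mem_sup_left ?_)
    rw [lowSpace, hn₁]
    exact Submodule.subset_span ⟨i, hin.1, j, hin.2, rfl⟩
  · rw [tensorFun_split _ (truncBSpline s k p₁ (p₁ - 1) p₂ s i) _
      (truncBSpline s k p₁ (p₁ - 1) p₂ s j)]
    refine Submodule.add_mem _ ?_ (Submodule.mem_sup_right (Submodule.add_mem _
      (tensorFun_mem_highSpace (bspline_sub_truncBSpline_mem (hmem i hi)) (hmem j hj))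
      (tensorFun_mem_highSpace' (truncBSpline_mem_span_inner _ _ _ _ _ _ _)
        (bspline_sub_truncBSpline_mem (hmem j hj)))))
    -- This disposes of the first and last indices, which no generator of the truncated part uses.
    by_cases hz : truncBSpline s k p₁ (p₁ - 1) p₂ s i = 0 ∨
        truncBSpline s k p₁ (p₁ - 1) p₂ s j = 0
    · have : tensorFun (truncBSpline s k p₁ (p₁ - 1) p₂ s i)
          (truncBSpline s k p₁ (p₁ - 1) p₂ s j) = 0 := by
        ext z
        rcases hz with hz | hz <;> simp [tensorFun, hz]
      rw [this]
      exact Submodule.zero_mem _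
    · have hi0 : i ≠ 0 := fun h => hz (Or.inl (h ▸ h0))
      have hi1 : i ≠ p₁ + k := fun h => hz (Or.inl (h ▸ h1))
      have hj0 : j ≠ 0 := fun h => hz (Or.inr (h ▸ h0))
      have hj1 : j ≠ p₁ + k := fun h => hz (Or.inr (h ▸ h1))
      refine Submodule.mem_sup_left (Submodule.mem_sup_right ?_)
      rw [truncSpace, hn₁]
      by_cases hii : i ∈ innerIdx s (p₁ + 1 + k)
      · refine Submodule.mem_sup_right (Submodule.subset_span ⟨i, hii, j, ?_, rfl⟩)
        have hjj : j ∉ innerIdx s (p₁ + 1 + k) := fun h => hin ⟨hii, h⟩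
        simp only [innerIdx, truncIdx, Set.mem_union, Set.mem_Icc] at hjj ⊢
        omega
      · refine Submodule.mem_sup_left (Submodule.subset_span ⟨i, ?_, j, ?_, rfl⟩)
        · simp only [innerIdx, truncIdx, Set.mem_union, Set.mem_Icc] at hii ⊢
          omega
        · rw [Set.mem_Icc]
          omega

theorem mixedSpace_le_tensorSplineSpace {s k p₁ r₁ p₂ r₂ : ℕ}
    (hle : splineSpace k p₁ r₁ ≤ splineSpace k p₂ r₂)
    (hn₁ : s + 2 ≤ numBSplines k p₁ r₁) (hn₂ : s + 2 ≤ numBSplines k p₂ r₂) :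
    mixedSpace s k p₁ r₁ p₂ r₂ ≤ tensorSplineSpace k p₂ r₂ := by
  have hlow : ∀ j ∈ innerIdx s (numBSplines k p₁ r₁), bspline k p₁ r₁ j ∈ splineSpace k p₂ r₂ := by
    intro j hj
    refine hle (bspline_mem_splineSpace ?_)
    simp only [innerIdx, Set.mem_Icc] at hj
    omega
  have htrunc : ∀ j, truncBSpline s k p₁ r₁ p₂ r₂ j ∈ splineSpace k p₂ r₂ := fun j =>
    Submodule.sum_mem _ fun i _ => Submodule.smul_mem _ _ (bspline_mem_splineSpace i.2)
  have hhigh : ∀ j ≤ numBSplines k p₂ r₂ - 1, bspline k p₂ r₂ j ∈ splineSpace k p₂ r₂ :=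
    fun j hj => bspline_mem_splineSpace (by omega)
  have hinner : ∀ j ∈ innerIdx s (numBSplines k p₂ r₂), bspline k p₂ r₂ j ∈ splineSpace k p₂ r₂ :=
    fun j hj => hhigh j (by simp only [innerIdx, Set.mem_Icc] at hj; omega)
  have houter : ∀ j ∈ outerIdx s (numBSplines k p₂ r₂), bspline k p₂ r₂ j ∈ splineSpace k p₂ r₂ :=
    fun j hj => hhigh j (by simp only [outerIdx, Set.mem_union, Set.mem_Icc] at hj; omega)
  exact sup_le (sup_le (prodSpan_le_tensorSplineSpace hlow hlow)
    (sup_le (prodSpan_le_tensorSplineSpace (fun j _ => htrunc j) fun j _ => htrunc j)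
      (prodSpan_le_tensorSplineSpace (fun j _ => htrunc j) fun j _ => htrunc j)))
    (sup_le (prodSpan_le_tensorSplineSpace houter fun j hj => hhigh j hj.2)
      (prodSpan_le_tensorSplineSpace hinner houter))

/-! ### Local reproduction of polynomials -/

theorem breakpoint_le_intCast_div {k b : ℕ} {m : ℤ} :
    breakpoint k b ≤ (m : ℝ) / ((k : ℝ) + 1) ↔ (b : ℤ) ≤ m := by
  rw [breakpoint, div_le_div_iff_of_pos_right (by positivity)]
  exact_mod_cast Iff.rfl

theorem intCast_div_le_breakpoint {k b : ℕ} {m : ℤ} :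
    (m : ℝ) / ((k : ℝ) + 1) ≤ breakpoint k b ↔ m ≤ (b : ℤ) := by
  rw [breakpoint, div_le_div_iff_of_pos_right (by positivity)]
  exact_mod_cast Iff.rfl

/-- A spline of maximal smoothness agrees on each mesh cell with a spline that vanishes more than
`p` cells away from that cell. -/
theorem exists_local_spline {k p a : ℕ} (hp : 1 ≤ p) (ha : a ≤ k) {f : unitInterval → ℝ}
    (hf : f ∈ splineSpace k p (p - 1)) :
    ∃ g ∈ splineSpace k p (p - 1),
      (∀ x : unitInterval, (x : ℝ) ∈ meshInterval k a (a + 1) → g x = f x) ∧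
      ∀ x : unitInterval, g x ≠ 0 → (x : ℝ) ∈ meshInterval k (a - p) (a + 1 + p) := by
  have hd : p - (p - 1) = 1 := by omega
  have hn : numBSplines k p (p - 1) = p + 1 + k := by rw [numBSplines, hd, mul_one]
  obtain ⟨c, rfl⟩ := exists_coeff_of_mem_splineSpace hf
  -- With simple interior knots the a-th cell is knot span p + a, so exactly these indices can be
  -- active on it.
  refine ⟨∑ j ∈ Finset.Icc a (a + p), c j • bspline k p (p - 1) j,
    Submodule.sum_mem _ fun j hj => Submodule.smul_mem _ _ (bspline_mem_splineSpace ?_),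
    fun x hx => ?_, fun x hx => ?_⟩
  · rw [Finset.mem_Icc] at hj
    omega
  · obtain ⟨b, hb, hx1, hx2, hx3, hspan⟩ := exists_cell k x
    have hspan := hspan p (p - 1) (by omega)
    rw [hd, mul_one] at hspan
    obtain ⟨hxa, hxb⟩ := hx
    rw [Finset.sum_apply, Finset.sum_apply]
    apply Finset.sum_subset
    · intro j
      rw [Finset.mem_Icc, Finset.mem_range]
      omega
    · intro j _ hj
      rw [Finset.mem_Icc] at hj
      have hab : a ≤ b := by
        rcases hx3 with h | ⟨rfl, -⟩
        · have := (breakpoint_strictMono k).lt_iff_lt.1 (lt_of_le_of_lt hxa h)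
          omega
        · exact ha
      have hba : (b : ℤ) ≤ a + 1 := by
        rw [← breakpoint_le_intCast_div (k := k)]
        exact hx1.trans hxb
      rw [Pi.smul_apply, smul_eq_mul]
      rcases hab.eq_or_lt with rfl | hlt
      · rw [bspline, hspan.eq_zero (by omega), mul_zero]
      -- The mesh cell is closed but knot spans are half open, so its right end may belong to the
      -- next span. The one additional active B-spline starts at that point and, having positive
      -- degree, vanishes there.
      · obtain rfl : b = a + 1 := by omega
        by_cases hj' : j = p + (a + 1)
        · obtain ⟨q, rfl⟩ : ∃ q, p = q + 1 := ⟨p - 1, by omega⟩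
          have hxe : (x : ℝ) = knot k (q + 1) (q + 1 - 1) (q + 1 + (a + 1)) := by
            have := knot_last_eq (k := k) (p := q + 1) (r := q + 1 - 1) (b := a + 1)
              (by omega) hb
            rw [hd, mul_one] at this
            rw [this]
            refine le_antisymm (hxb.trans ?_) hx1
            rw [intCast_div_le_breakpoint]
            push_cast
            exact le_rfl
          rw [bspline, hj', hspan.succ_self_eq_zero hxe, mul_zero]
        · rw [bspline, hspan.eq_zero (by omega), mul_zero]
  · obtain ⟨b, hb, hx1, hx2, hx3, hspan⟩ := exists_cell k x
    have hspan := hspan p (p - 1) (by omega)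
    rw [hd, mul_one] at hspan
    rw [Finset.sum_apply] at hx
    obtain ⟨j, hj, hne⟩ := Finset.exists_ne_zero_of_sum_ne_zero hx
    rw [Finset.mem_Icc] at hj
    -- Activity on cell b means b ≤ j ≤ b + p. Together with a ≤ j ≤ a + p this puts b within p
    -- cells of a.
    have := hspan.active p j (right_ne_zero_of_mul hne)
    refine ⟨le_trans ?_ hx1, hx2.trans ?_⟩
    · rw [intCast_div_le_breakpoint]
      omega
    · rw [breakpoint_le_intCast_div]
      omega

theorem pow_mem_splineSpace {k p r e : ℕ} (hr : r < p) (he : e ≤ p) :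
    (fun x : unitInterval => (x : ℝ) ^ e) ∈ splineSpace k p r := by
  have h : truncPow k (0, e) ∈ splineSpace k p r := by
    refine truncPow_mem_splineSpace hr ?_
    rw [truncPowIdx, Finset.mem_union, Finset.mem_product]
    left
    simpa [Nat.lt_succ_iff] using he
  have heq : (fun x : unitInterval => (x : ℝ) ^ e) = (-1 : ℝ) ^ e • truncPow k (0, e) := by
    ext x
    simp only [truncPow, Pi.smul_apply, smul_eq_mul, breakpoint_zero, if_pos x.2.1]
    rw [← mul_pow]
    congr 1
    ring
  rw [heq]
  exact Submodule.smul_mem _ _ h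

theorem polyFun_eq_sum (q : MvPolynomial (Fin 2) ℝ) :
    polyFun q = ∑ d ∈ q.support, q.coeff d •
      tensorFun (fun x => (x : ℝ) ^ d 0) (fun y => (y : ℝ) ^ d 1) := by
  ext z
  rw [polyFun, MvPolynomial.eval_eq']
  simp [tensorFun, Fin.prod_univ_two]

theorem locallyReproduces_tensorSplineSpace {k p : ℕ} (hp : 1 ≤ p) :
    LocallyReproduces k p (tensorSplineSpace k p (p - 1)) := by
  intro q hq
  have hdeg : ∀ d ∈ q.support, ∀ i, d i ≤ p := fun d hd i =>
    MvPolynomial.degreeOf_le_iff.1 (hq i) d hd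
  rw [polyFun_eq_sum]
  refine ⟨Submodule.sum_mem _ fun d hd => Submodule.smul_mem _ _
    (tensorFun_mem_tensorSplineSpace (pow_mem_splineSpace (by omega) (hdeg d hd 0))
      (pow_mem_splineSpace (by omega) (hdeg d hd 1))), fun a b ha hb => ?_⟩
  -- The bound e ≤ p sits inside the existential so that `choose` yields a function of every
  -- exponent.
  have hloc : ∀ c ≤ k, ∀ e : ℕ, ∃ g : unitInterval → ℝ, e ≤ p → g ∈ splineSpace k p (p - 1) ∧
      (∀ x : unitInterval, (x : ℝ) ∈ meshInterval k c (c + 1) → g x = (x : ℝ) ^ e) ∧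
      ∀ x : unitInterval, g x ≠ 0 → (x : ℝ) ∈ meshInterval k (c - p) (c + 1 + p) := by
    intro c hc e
    by_cases he : e ≤ p
    · obtain ⟨g, h⟩ := exists_local_spline hp hc
        (pow_mem_splineSpace (k := k) (p := p) (r := p - 1) (by omega) he)
      exact ⟨g, fun _ => h⟩
    · exact ⟨0, fun h => absurd h he⟩
  choose g hg using hloc a ha
  choose g' hg' using hloc b hb
  refine ⟨∑ d ∈ q.support, q.coeff d • tensorFun (g (d 0)) (g' (d 1)),
    Submodule.sum_mem _ fun d hd => Submodule.smul_mem _ _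
      (tensorFun_mem_tensorSplineSpace (hg _ (hdeg d hd 0)).1 (hg' _ (hdeg d hd 1)).1),
    fun z hz1 hz2 => ?_, fun z hz => ?_⟩
  · rw [Finset.sum_apply, Finset.sum_apply]
    refine Finset.sum_congr rfl fun d hd => ?_
    simp only [Pi.smul_apply, tensorFun]
    rw [(hg _ (hdeg d hd 0)).2.1 _ hz1, (hg' _ (hdeg d hd 1)).2.1 _ hz2]
  · rw [Finset.sum_apply] at hz
    obtain ⟨d, hd, hne⟩ := Finset.exists_ne_zero_of_sum_ne_zero hz
    have hne : g (d 0) z.1 * g' (d 1) z.2 ≠ 0 := right_ne_zero_of_mul hne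
    exact ⟨(hg _ (hdeg d hd 0)).2.2 _ (left_ne_zero_of_mul hne),
      (hg' _ (hdeg d hd 1)).2.2 _ (right_ne_zero_of_mul hne)⟩

theorem LocallyReproduces.mono {k p : ℕ} {V W : Submodule ℝ (unitInterval × unitInterval → ℝ)}
    (h : LocallyReproduces k p V) (hVW : V ≤ W) : LocallyReproduces k p W := fun q hq =>
  ⟨hVW (h q hq).1, fun a b ha hb =>
    let ⟨f, hf, hf'⟩ := (h q hq).2 a b ha hb
    ⟨f, hVW hf, hf'⟩⟩

end MixedSpline

theorem theorem3 (s k p₁ r₁ p₂ r₂ : ℕ) (hs : 1 ≤ s)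
    (hp₂ : p₂ = 2 * s + 1) (hr₂ : r₂ = s) (hr₁ : r₁ = p₁ - 1)
    (hp₁ : s + 1 ≤ p₁) (hp₁' : p₁ ≤ 2 * s + 1)
    (hk : max (2 * (s + 1) - p₁) 2 ≤ k) :
    MixedSpline.tensorSplineSpace k p₁ r₁ ≤ MixedSpline.mixedSpace s k p₁ r₁ p₂ r₂ ∧
    MixedSpline.mixedSpace s k p₁ r₁ p₂ r₂ ≤ MixedSpline.tensorSplineSpace k p₂ r₂ ∧
    MixedSpline.LocallyReproduces k p₁ (MixedSpline.mixedSpace s k p₁ r₁ p₂ r₂) := by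
  subst hr₁ hr₂
  have hle := MixedSpline.tensorSplineSpace_le_mixedSpace hs hp₂ hp₁ hp₁' hk
  refine ⟨hle, MixedSpline.mixedSpace_le_tensorSplineSpace
    (MixedSpline.splineSpace_mono (by omega) (by omega) (by omega) (by omega)) ?_ ?_,
    (MixedSpline.locallyReproduces_tensorSplineSpace (by omega)).mono hle⟩
  · have h2 : 2 ≤ k := (le_max_right _ _).trans hk
    rw [MixedSpline.numBSplines, show p₁ - (p₁ - 1) = 1 by omega]
    omega
  · rw [MixedSpline.numBSplines, hp₂]
    omega
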